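/- Let $n\ge 1$ and let $\mathbb D$ be the open unit disc in $\mathbb C$. Let $\pi_n:\mathbb C^n\to\mathbb C^n$ be the map whose $k$-th component is the elementary symmetric polynomial $$\pi_{n,k}(\lambda_1,\dots,\lambda_n)=\sum_{1\le j_1<\dots<j_k\le n}\lambda_{j_1}\cdots\lambda_{j_k},\qquad k=1,\dots,n,$$ and let $\mathbb G_n=\pi_n(\mathbb D^n)$ be the symmetrized polydisc. A (nonconstant) finite Blaschke product is a function on $\mathbb D$ of the form $B(z)=c\prod_{i=1}^m\frac{z-a_i}{1-\overline{a_i}z}$ with $m\ge 1$, $|c|=1$ and $a_1,\dots,a_m\in\mathbb D$. Let $f:\mathbb D^n\to\mathbb G_n$ be a holomorphic mapping. Then $f$ is proper (as a map from $\mathbb D^n$ to $\mathbb G_n$) if and only if there exist finite Blaschke products $B_1,\dots,B_n$ such that $$f(\lambda_1,\dots,\lambda_n)=\pi_n\big(B_1(\lambda_1),\dots,B_n(\lambda_n)\big),\qquad \lambda_1,\dots,\lambda_n\in\mathbb D.$$ -/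

import Mathlib

/-- The open unit polydisc `𝔻ⁿ` in `ℂⁿ`. -/
def polydisc (n : ℕ) : Set (Fin n → ℂ) :=
  {z | ∀ j, ‖z j‖ < 1}

/-- The symmetrization map `π_n : ℂⁿ → ℂⁿ`. Its `k`-th component is the elementary symmetric
polynomial of degree `k`; as `Fin n` counts from `0`, the entry with index `k : Fin n`
has degree `k + 1`. -/
def symmetrization (n : ℕ) (z : Fin n → ℂ) : Fin n → ℂ :=
  fun k => ∑ s ∈ Finset.powersetCard ((k : ℕ) + 1) (Finset.univ : Finset (Fin n)), ∏ j ∈ s, z j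

/-- The symmetrized polydisc `𝔾_n = π_n(𝔻ⁿ)`. -/
def symmetrizedPolydisc (n : ℕ) : Set (Fin n → ℂ) :=
  symmetrization n '' polydisc n

/-- `B` is, on the open unit disc, a finite Blaschke product: a unimodular constant times a
nonempty finite product of Blaschke factors with zeros (repetitions allowed) in the disc. -/
def IsFiniteBlaschkeProduct (B : ℂ → ℂ) : Prop :=
  ∃ (m : ℕ) (c : ℂ) (a : Fin m → ℂ), 1 ≤ m ∧ ‖c‖ = 1 ∧ (∀ i, ‖a i‖ < 1) ∧
    ∀ z : ℂ, ‖z‖ < 1 → B z = c * ∏ i, (z - a i) / (1 - (starRingEnd ℂ) (a i) * z)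

/-! A point of the symmetrized polydisc is a monic polynomial of degree n with all roots in the
disc, so f is a holomorphic family `P μ` of such polynomials. For proper f the claim is that `P μ`
is the product of the factors X - b_j(μ_j).

When z = μ_i tends to the circle and the other variables vanish, properness gives a root W(z) with
|W(z)| → 1. For |c| = 1 the value P_μ(c) never vanishes and is bounded, so Harnack's inequality in
the other variables, with an exponent independent of z, carries smallness from the centre to every μ
(`tendsto_eval_root`). Hence the resultant of the member over the centre with any linear combination
of members having the same μ_i = z tends to 0 at the circle, and so vanishes. Each combination
therefore shares a root with one fixed polynomial; since a complex vector space is not a finite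
union of proper subspaces, a single root b_i(z) serves all members (`exists_common_root`).

A constant root could be divided out, leaving degree n - 1, whereas n variables force degree at
least n (`le_natDegree`). So a small perturbation makes the b_j(μ_j) distinct; Vieta then gives
holomorphy of b_i, and continuity extends the factorization to the whole polydisc. Finally |b_i| → 1
at the circle, which characterizes finite Blaschke products. The converse is a compactness argument.
-/

open Filter Topology Metric Set Complex Polynomial

/-! ### Boundary behaviour and the maximum principle on the disc. -/

/-- The filter describing approach to the unit circle from inside the unit disc. -/
noncomputable def unitCircleFilter : Filter ℂ := Filter.comap (fun z : ℂ => ‖z‖) (𝓝[<] (1 : ℝ))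

lemma eventually_unitCircleFilter {p : ℂ → Prop} :
    (∀ᶠ z in unitCircleFilter, p z) ↔ ∃ r < (1 : ℝ), ∀ z : ℂ, r < ‖z‖ → ‖z‖ < 1 → p z := by
  have h := (nhdsLT_basis (1 : ℝ)).comap (fun z : ℂ => ‖z‖)
  rw [unitCircleFilter, h.eventually_iff]
  simp only [mem_preimage, mem_Ioo, and_imp]

lemma eventually_norm_lt_one : ∀ᶠ z in unitCircleFilter, ‖z‖ < 1 :=
  eventually_unitCircleFilter.2 ⟨0, zero_lt_one, fun _ _ h => h⟩

lemma eventually_lt_norm {r : ℝ} (hr : r < 1) : ∀ᶠ z in unitCircleFilter, r < ‖z‖ :=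
  eventually_unitCircleFilter.2 ⟨r, hr, fun _ h _ => h⟩

lemma tendsto_norm_unitCircleFilter :
    Tendsto (fun z : ℂ => ‖z‖) unitCircleFilter (𝓝 1) :=
  tendsto_comap.mono_right nhdsWithin_le_nhds

/-- Maximum principle on the unit disc, with boundary values controlled along
`unitCircleFilter`. -/
lemma norm_le_of_eventually_norm_le {h : ℂ → ℂ} (hh : DifferentiableOn ℂ h (ball 0 1)) {C : ℝ}
    (hC : ∀ ε > 0, ∀ᶠ z in unitCircleFilter, ‖h z‖ ≤ C + ε) {z : ℂ} (hz : ‖z‖ < 1) :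
    ‖h z‖ ≤ C := by
  refine le_of_forall_pos_le_add fun ε hε => ?_
  obtain ⟨r, hr, H⟩ := eventually_unitCircleFilter.1 (hC ε hε)
  obtain ⟨s, hs, hs1⟩ := exists_between (max_lt hr hz)
  have hzs : ‖z‖ < s := (le_max_right _ _).trans_lt hs
  have hs0 : s ≠ 0 := ((norm_nonneg z).trans_lt hzs).ne'
  refine norm_le_of_forall_mem_frontier_norm_le (U := ball 0 s) isBounded_ball ?_ ?_
    (subset_closure (by simpa using hzs))
  · refine DifferentiableOn.diffContOnCl (hh.mono ?_)
    rw [closure_ball _ hs0]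
    exact closedBall_subset_ball hs1
  · intro x hx
    rw [frontier_ball _ hs0] at hx
    have hx' : ‖x‖ = s := by simpa using hx
    exact H x (hx' ▸ (le_max_left _ _).trans_lt hs) (hx' ▸ hs1)

lemma eq_zero_of_tendsto_zero {h : ℂ → ℂ} (hh : DifferentiableOn ℂ h (ball 0 1))
    (h0 : Tendsto h unitCircleFilter (𝓝 0)) {z : ℂ} (hz : ‖z‖ < 1) : h z = 0 := by
  refine norm_le_zero_iff.1 (norm_le_of_eventually_norm_le hh (fun ε hε => ?_) hz)
  have := (tendsto_zero_iff_norm_tendsto_zero.1 h0).eventually (gt_mem_nhds hε)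
  filter_upwards [this] with x hx
  linarith

/-! ### Holomorphic logarithms and Harnack's inequality. -/

/-- A holomorphic function without zeros on a disc has a holomorphic logarithm. -/
lemma exists_exp_eq_of_ne_zero {g : ℂ → ℂ} {R : ℝ} (hR : 0 < R)
    (hg : DifferentiableOn ℂ g (ball 0 R)) (h0 : ∀ z ∈ ball (0 : ℂ) R, g z ≠ 0) :
    ∃ u : ℂ → ℂ, DifferentiableOn ℂ u (ball 0 R) ∧ ∀ z ∈ ball (0 : ℂ) R, exp (u z) = g z := by
  have hd : DifferentiableOn ℂ (fun z => deriv g z / g z) (ball 0 R) :=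
    (hg.deriv isOpen_ball).div hg h0
  obtain ⟨v, hv⟩ := hd.isExactOn_ball
  have h0R : (0 : ℂ) ∈ ball (0 : ℂ) R := mem_ball_self hR
  have hvd : DifferentiableOn ℂ v (ball 0 R) := fun z hz =>
    (hv z hz).differentiableAt.differentiableWithinAt
  refine ⟨fun z => v z + (log (g 0) - v 0), hvd.add_const _, fun z hz => ?_⟩
  have hconst : ∀ z ∈ ball (0 : ℂ) R,
      HasDerivAt (fun z => exp (-v z) * g z) 0 z := by
    intro z hz
    have h1 := ((hv z hz).neg.cexp).mul
      ((hg z hz).differentiableAt (isOpen_ball.mem_nhds hz)).hasDerivAt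
    refine h1.congr_deriv ?_
    rw [mul_neg, neg_mul, mul_assoc, div_mul_cancel₀ _ (h0 z hz), neg_add_cancel]
  have heq : exp (-v z) * g z = exp (-v 0) * g 0 :=
    isOpen_ball.is_const_of_deriv_eq_zero (convex_ball _ _).isPreconnected
      (fun z hz => (hconst z hz).differentiableAt.differentiableWithinAt)
      (fun z hz => (hconst z hz).deriv) hz h0R
  have h2 : exp (v z + (log (g 0) - v 0)) = exp (v z) * (exp (-v 0) * g 0) := by
    rw [exp_add, sub_eq_neg_add, exp_add, exp_log (h0 0 h0R)]
  simp only [h2, ← heq, ← mul_assoc, ← exp_add, add_neg_cancel, exp_zero, one_mul]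

/-- Harnack's inequality for `-log ‖g‖`, where `g` has no zeros and is bounded by one. -/
lemma norm_le_rpow_of_ne_zero {g : ℂ → ℂ} {R : ℝ} (hR : 1 < R)
    (hg : DifferentiableOn ℂ g (ball 0 R)) (h0 : ∀ z ∈ ball (0 : ℂ) R, g z ≠ 0)
    (h1 : ∀ z ∈ ball (0 : ℂ) R, ‖g z‖ ≤ 1) :
    ‖g 1‖ ≤ ‖g 0‖ ^ ((R - 1) / (R + 1)) := by
  have hR0 : 0 < R := by linarith
  obtain ⟨u, hu, hug⟩ := exists_exp_eq_of_ne_zero hR0 hg h0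
  have m0 : (0 : ℂ) ∈ ball (0 : ℂ) R := mem_ball_self hR0
  have m1 : (1 : ℂ) ∈ ball (0 : ℂ) R := by simpa using hR
  have hnorm : ∀ z ∈ ball (0 : ℂ) R, ‖g z‖ = Real.exp (u z).re := fun z hz => by
    rw [← hug z hz, norm_exp]
  have hre : ∀ z ∈ ball (0 : ℂ) R, (u z).re ≤ 0 := fun z hz => by
    simpa [hnorm z hz] using h1 z hz
  rw [hnorm 0 m0, hnorm 1 m1, ← Real.exp_mul, Real.exp_le_exp]
  rcases (hre 0 m0).eq_or_lt with ha | ha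
  · rw [ha, zero_mul]; exact hre 1 m1
  set a : ℝ := -(u 0).re with hadef
  have ha0 : 0 < a := by linarith
  -- The function F has nonnegative real part and F(0) = a > 0, so its Cayley transform (F - a)/(F +
  -- a) fixes the origin and maps into the closed unit disc. The Schwarz lemma at the point 1 bounds
  -- it by 1/R.
  set F : ℂ → ℂ := fun z => -u z + (u 0).im * I with hF
  have hF0 : F 0 = a := by
    apply Complex.ext <;> simp [hF, hadef]
  have hFre : ∀ z ∈ ball (0 : ℂ) R, 0 ≤ (F z).re := fun z hz => by
    simpa [hF] using hre z hz
  have hne : ∀ z ∈ ball (0 : ℂ) R, F z + a ≠ 0 := fun z hz h => by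
    have := congrArg Complex.re h
    simp only [add_re, ofReal_re, zero_re] at this
    linarith [hFre z hz]
  have hsch := dist_le_div_mul_dist_of_mapsTo_ball (f := fun z => (F z - a) / (F z + a))
    (c := 0) (z := 1) (R₁ := R) (R₂ := 1)
    (((hu.neg.add_const _).sub_const _).div ((hu.neg.add_const _).add_const _) hne)
    (fun z hz => ?_) m1
  · simp only [hF0, sub_self, zero_div, dist_zero_right, norm_one, mul_one, norm_div] at hsch
    rw [div_le_div_iff₀ (norm_pos_iff.2 (hne 1 m1)) hR0, one_mul] at hsch
    have hsq : (‖F 1 - a‖ * R) ^ 2 ≤ ‖F 1 + a‖ ^ 2 := by gcongr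
    rw [mul_pow, Complex.sq_norm, Complex.sq_norm, normSq_apply, normSq_apply] at hsq
    simp only [sub_re, sub_im, add_re, add_im, ofReal_re, ofReal_im, sub_zero, add_zero] at hsq
    have hx : (F 1).re = -(u 1).re := by simp [hF]
    have hx0 := hFre 1 m1
    have hR2 : 0 ≤ R ^ 2 - 1 := by nlinarith
    -- As R > 1, the imaginary part only strengthens the left side and can be dropped.
    have hsq' : ((a - (F 1).re) * R) ^ 2 ≤ ((F 1).re + a) ^ 2 := by
      nlinarith [mul_nonneg hR2 (mul_self_nonneg (F 1).im)]
    have hlin := abs_le_of_sq_le_sq hsq' (by linarith)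
    have hlin' := (abs_le.1 hlin).2
    rw [← neg_le_neg_iff, ← neg_mul, ← hx, ← hadef, ← mul_div_assoc, div_le_iff₀ (by linarith)]
    nlinarith
  · simp only [hF0, sub_self, zero_div, mem_closedBall, dist_zero_right, norm_div]
    refine div_le_one_of_le₀ ?_ (norm_nonneg _)
    rw [← sq_le_sq₀ (norm_nonneg _) (norm_nonneg _), Complex.sq_norm, Complex.sq_norm,
      normSq_apply, normSq_apply]
    simp only [sub_re, sub_im, add_re, add_im, ofReal_re, ofReal_im, sub_zero, add_zero]
    nlinarith [hFre z hz]

/-! ### Finite Blaschke products. -/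

/-- The Blaschke factor of the unit disc vanishing at `a`. -/
noncomputable def blaschkeFactor (a z : ℂ) : ℂ := (z - a) / (1 - (starRingEnd ℂ) a * z)

lemma one_sub_conj_mul_ne_zero {a z : ℂ} (ha : ‖a‖ < 1) (hz : ‖z‖ < 1) :
    1 - (starRingEnd ℂ) a * z ≠ 0 := by
  intro h
  have h1 : ‖(starRingEnd ℂ) a * z‖ = 1 := by
    rw [← sub_eq_zero.1 h, norm_one]
  rw [norm_mul, RCLike.norm_conj] at h1
  nlinarith [norm_nonneg a, norm_nonneg z]

lemma norm_blaschkeFactor_sq {a z : ℂ} (ha : ‖a‖ < 1) (hz : ‖z‖ < 1) :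
    ‖blaschkeFactor a z‖ ^ 2 =
      1 - (1 - ‖a‖ ^ 2) * (1 - ‖z‖ ^ 2) / ‖1 - (starRingEnd ℂ) a * z‖ ^ 2 := by
  have h := one_sub_conj_mul_ne_zero ha hz
  have h' : ‖1 - (starRingEnd ℂ) a * z‖ ^ 2 ≠ 0 := by positivity
  rw [blaschkeFactor, norm_div, div_pow, eq_sub_iff_add_eq, ← add_div, div_eq_one_iff_eq h']
  simp only [Complex.sq_norm, normSq_apply, sub_re, sub_im, mul_re, mul_im, conj_re, conj_im,
    one_re, one_im]
  ring

lemma norm_one_sub_conj_mul_le {a z : ℂ} (ha : ‖a‖ < 1) (hz : ‖z‖ < 1) :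
    ‖1 - (starRingEnd ℂ) a * z‖ ≤ 2 := by
  refine (norm_sub_le _ _).trans ?_
  rw [norm_mul, RCLike.norm_conj, norm_one]
  nlinarith [norm_nonneg a, norm_nonneg z]

lemma tendsto_norm_blaschkeFactor {a : ℂ} (ha : ‖a‖ < 1) :
    Tendsto (fun z => ‖blaschkeFactor a z‖) unitCircleFilter (𝓝 1) := by
  have hsq : Tendsto (fun z => ‖blaschkeFactor a z‖ ^ 2) unitCircleFilter (𝓝 1) := by
    have hl : Tendsto (fun z : ℂ => 1 - (1 - ‖a‖ ^ 2) * (1 - ‖z‖ ^ 2) / (1 - ‖a‖) ^ 2)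
        unitCircleFilter (𝓝 (1 - (1 - ‖a‖ ^ 2) * (1 - 1 ^ 2) / (1 - ‖a‖) ^ 2)) :=
      ((((tendsto_norm_unitCircleFilter.pow 2).const_sub 1).const_mul _).div_const _).const_sub 1
    simp only [one_pow, sub_self, mul_zero, zero_div, sub_zero] at hl
    refine tendsto_of_tendsto_of_tendsto_of_le_of_le' hl tendsto_const_nhds ?_ ?_
    · filter_upwards [eventually_norm_lt_one] with z hz
      rw [norm_blaschkeFactor_sq ha hz]
      have h1 : 0 ≤ 1 - ‖a‖ ^ 2 := by nlinarith [norm_nonneg a]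
      have h2 : 0 ≤ 1 - ‖z‖ ^ 2 := by nlinarith [norm_nonneg z]
      have h3 : 0 < 1 - ‖a‖ := by linarith
      have h4 : 1 - ‖a‖ ≤ ‖1 - (starRingEnd ℂ) a * z‖ := by
        have := norm_sub_norm_le 1 ((starRingEnd ℂ) a * z)
        rw [norm_mul, RCLike.norm_conj, norm_one] at this
        nlinarith [norm_nonneg a, norm_nonneg z]
      gcongr
    · filter_upwards [eventually_norm_lt_one] with z hz
      rw [norm_blaschkeFactor_sq ha hz]
      have h1 : 0 ≤ 1 - ‖a‖ ^ 2 := by nlinarith [norm_nonneg a]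
      have h2 : 0 ≤ 1 - ‖z‖ ^ 2 := by nlinarith [norm_nonneg z]
      have : 0 ≤ (1 - ‖a‖ ^ 2) * (1 - ‖z‖ ^ 2) / ‖1 - (starRingEnd ℂ) a * z‖ ^ 2 := by positivity
      linarith
  simpa using hsq.sqrt

lemma tendsto_norm_of_isFiniteBlaschkeProduct {B : ℂ → ℂ} (hB : IsFiniteBlaschkeProduct B) :
    Tendsto (fun z => ‖B z‖) unitCircleFilter (𝓝 1) := by
  obtain ⟨m, c, a, -, hc, ha, h⟩ := hB
  have h1 : Tendsto (fun z => ‖c‖ * ∏ i, ‖blaschkeFactor (a i) z‖) unitCircleFilter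
      (𝓝 (‖c‖ * ∏ _i : Fin m, 1)) :=
    (tendsto_finsetProd _ fun i _ => tendsto_norm_blaschkeFactor (ha i)).const_mul _
  rw [hc, Finset.prod_const_one, one_mul] at h1
  refine h1.congr' ?_
  filter_upwards [eventually_norm_lt_one] with z hz
  rw [h z hz, norm_mul, hc, norm_prod]
  rfl

/-- A zero-free holomorphic function on the disc with unimodular boundary values is constant. -/
lemma eq_const_of_tendsto_norm_one {B : ℂ → ℂ} (hB : DifferentiableOn ℂ B (ball 0 1))
    (hlim : Tendsto (fun z => ‖B z‖) unitCircleFilter (𝓝 1))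
    (h0 : ∀ z, ‖z‖ < 1 → B z ≠ 0) : ∃ c : ℂ, ‖c‖ = 1 ∧ ∀ z, ‖z‖ < 1 → B z = c := by
  have hev : ∀ ε > 0, ∀ᶠ z in unitCircleFilter, ‖B z‖ ≤ 1 + ε := fun ε hε =>
    (hlim.eventually (gt_mem_nhds (show (1 : ℝ) < 1 + ε by linarith))).mono fun _ h => h.le
  have hle : ∀ z, ‖z‖ < 1 → ‖B z‖ ≤ 1 := fun z hz => norm_le_of_eventually_norm_le hB hev hz
  have hinv : DifferentiableOn ℂ (fun z => (B z)⁻¹) (ball 0 1) :=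
    hB.inv fun z hz => h0 z (by simpa using hz)
  have hlim' : Tendsto (fun z => ‖(B z)⁻¹‖) unitCircleFilter (𝓝 1) := by
    simpa using hlim.inv₀ one_ne_zero
  have hev' : ∀ ε > 0, ∀ᶠ z in unitCircleFilter, ‖(B z)⁻¹‖ ≤ 1 + ε := fun ε hε =>
    (hlim'.eventually (gt_mem_nhds (show (1 : ℝ) < 1 + ε by linarith))).mono fun _ h => h.le
  have hone : ∀ z, ‖z‖ < 1 → ‖B z‖ = 1 := fun z hz => by
    have h1 := norm_le_of_eventually_norm_le hinv hev' hz
    rw [norm_inv] at h1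
    exact le_antisymm (hle z hz) ((inv_le_one₀ (norm_pos_iff.2 (h0 z hz))).1 h1)
  refine ⟨B 0, hone 0 (by simp), fun z hz => ?_⟩
  refine eqOn_of_isPreconnected_of_isMaxOn_norm (convex_ball (0 : ℂ) 1).isPreconnected isOpen_ball
    hB (mem_ball_self one_pos) (fun x hx => ?_) (by simpa using hz)
  simp only [Function.comp_apply, mem_ofPred_eq]
  rw [hone 0 (by simp)]
  exact hle x (by simpa using hx)

/-- Splitting a Blaschke factor off a holomorphic function with a zero in the disc. -/
lemma exists_eq_blaschkeFactor_mul {B : ℂ → ℂ} (hB : DifferentiableOn ℂ B (ball 0 1))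
    (hlim : Tendsto (fun z => ‖B z‖) unitCircleFilter (𝓝 1)) {a : ℂ} (ha : ‖a‖ < 1)
    (hBa : B a = 0) :
    ∃ g : ℂ → ℂ, DifferentiableOn ℂ g (ball 0 1) ∧
      Tendsto (fun z => ‖g z‖) unitCircleFilter (𝓝 1) ∧
      ∀ z, ‖z‖ < 1 → B z = blaschkeFactor a z * g z := by
  have ha' : ball (0 : ℂ) 1 ∈ 𝓝 a := isOpen_ball.mem_nhds (by simpa using ha)
  set g : ℂ → ℂ := fun z => (1 - (starRingEnd ℂ) a * z) * dslope B a z with hg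
  have hmul : ∀ z, ‖z‖ < 1 → B z = blaschkeFactor a z * g z := by
    intro z hz
    have h := sub_smul_dslope B a z
    rw [hBa, sub_zero, smul_eq_mul] at h
    rw [blaschkeFactor, hg, ← mul_assoc, div_mul_cancel₀ _ (one_sub_conj_mul_ne_zero ha hz), h]
  refine ⟨g, ?_, ?_, hmul⟩
  · exact DifferentiableOn.mul (by fun_prop) ((differentiableOn_dslope ha').2 hB)
  · have h1 := hlim.div (tendsto_norm_blaschkeFactor ha) one_ne_zero
    rw [div_one] at h1
    refine h1.congr' ?_
    filter_upwards [eventually_norm_lt_one, eventually_lt_norm ha] with z hz hz'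
    have hne : blaschkeFactor a z ≠ 0 :=
      div_ne_zero (sub_ne_zero.2 fun h => by simp [h] at hz') (one_sub_conj_mul_ne_zero ha hz)
    rw [Pi.div_apply, hmul z hz, norm_mul, mul_div_cancel_left₀ _ (norm_ne_zero_iff.2 hne)]

/-- Dividing out a zero multiplies the modulus at z₀ by at least 1/ρ, while the maximum principle
keeps it at most 1. Thus `N` bounds the number of divisions, and for `N = 0` the hypothesis is
contradictory. -/
lemma exists_eq_prod_blaschkeFactor {r : ℝ} {z₀ : ℂ}
    (hz₀ : ‖z₀‖ < 1) {ρ : ℝ} (hρ0 : 0 < ρ)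
    (hρ : ∀ a : ℂ, ‖a‖ ≤ r → ‖blaschkeFactor a z₀‖ ≤ ρ) (N : ℕ) :
    ∀ B : ℂ → ℂ, DifferentiableOn ℂ B (ball 0 1) →
      Tendsto (fun z => ‖B z‖) unitCircleFilter (𝓝 1) →
      (∀ z, ‖z‖ < 1 → B z = 0 → ‖z‖ ≤ r) → ρ ^ N < ‖B z₀‖ →
      ∃ (m : ℕ) (c : ℂ) (a : Fin m → ℂ), ‖c‖ = 1 ∧ (∀ i, ‖a i‖ < 1) ∧
        ∀ z : ℂ, ‖z‖ < 1 → B z = c * ∏ i, blaschkeFactor (a i) z := by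
  induction N with
  | zero =>
    intro B hB hlim _ hN
    have hev : ∀ ε > 0, ∀ᶠ z in unitCircleFilter, ‖B z‖ ≤ 1 + ε := fun ε hε =>
      (hlim.eventually (gt_mem_nhds (show (1 : ℝ) < 1 + ε by linarith))).mono fun _ h => h.le
    have := norm_le_of_eventually_norm_le hB hev hz₀
    rw [pow_zero] at hN
    linarith
  | succ N ih =>
    intro B hB hlim hzero hN
    by_cases h0 : ∀ z, ‖z‖ < 1 → B z ≠ 0
    · obtain ⟨c, hc, h⟩ := eq_const_of_tendsto_norm_one hB hlim h0
      exact ⟨0, c, Fin.elim0, hc, fun i => i.elim0, fun z hz => by simp [h z hz]⟩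
    · push Not at h0
      obtain ⟨a, ha, hBa⟩ := h0
      obtain ⟨g, hg, hglim, hmul⟩ := exists_eq_blaschkeFactor_mul hB hlim ha hBa
      have hgN : ρ ^ N < ‖g z₀‖ := by
        rw [hmul z₀ hz₀, norm_mul, pow_succ] at hN
        have h1 := hρ a (hzero a ha hBa)
        have h2 : ‖blaschkeFactor a z₀‖ * ‖g z₀‖ ≤ ρ * ‖g z₀‖ := by gcongr
        nlinarith
      obtain ⟨m, c, b, hc, hb, h⟩ := ih g hg hglim
        (fun z hz hgz => hzero z hz (by rw [hmul z hz, hgz, mul_zero])) hgN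
      refine ⟨m + 1, c, Fin.cons a b, hc, Fin.cases ha hb, fun z hz => ?_⟩
      rw [hmul z hz, h z hz, Fin.prod_univ_succ]
      simp only [Fin.cons_zero, Fin.cons_succ]
      ring

/-- A holomorphic self-map of the disc whose modulus tends to one at the boundary
is a finite Blaschke product. -/
theorem isFiniteBlaschkeProduct_of_tendsto_norm {B : ℂ → ℂ}
    (hB : DifferentiableOn ℂ B (ball 0 1)) (hB1 : ∀ z, ‖z‖ < 1 → ‖B z‖ < 1)
    (hlim : Tendsto (fun z => ‖B z‖) unitCircleFilter (𝓝 1)) : IsFiniteBlaschkeProduct B := by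
  obtain ⟨r, hr, hr0⟩ := eventually_unitCircleFilter.1
    (hlim.eventually (lt_mem_nhds (zero_lt_one' ℝ)))
  obtain ⟨t, ht, ht1⟩ := exists_between (max_lt hr (zero_lt_one' ℝ))
  have ht0 : 0 < t := (le_max_right _ _).trans_lt ht
  have hrt : r < t := (le_max_left _ _).trans_lt ht
  have hnt : ‖(t : ℂ)‖ = t := by simp [abs_of_pos ht0]
  have hz₀ : ‖(t : ℂ)‖ < 1 := by rwa [hnt]
  have hBt : 0 < ‖B t‖ := hr0 t (by rwa [hnt]) hz₀
  set R := max r 0 with hRdef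
  have hR1 : R < 1 := max_lt hr zero_lt_one
  have hR0 : 0 ≤ R := le_max_right _ _
  -- All zeros satisfy |a| ≤ R. Since |1 - āt| ≤ 2, the formula for the squared modulus of a
  -- Blaschke factor gives the uniform bound 1 - q at the point t, where B does not vanish.
  set q : ℝ := (1 - R ^ 2) * (1 - t ^ 2) / 4 with hq
  have hR2 : 0 < 1 - R ^ 2 := by nlinarith
  have ht2 : 0 < 1 - t ^ 2 := by nlinarith
  have hq0 : 0 < q := by positivity
  have hq1 : q < 1 := by
    rw [hq, div_lt_one (by norm_num)]
    nlinarith [sq_nonneg R, sq_nonneg t]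
  have hρ : ∀ a : ℂ, ‖a‖ ≤ R → ‖blaschkeFactor a t‖ ≤ √(1 - q) := by
    intro a ha
    refine Real.le_sqrt_of_sq_le ?_
    have ha1 : ‖a‖ < 1 := ha.trans_lt hR1
    rw [norm_blaschkeFactor_sq ha1 hz₀, hnt]
    have h2 : 0 < ‖1 - (starRingEnd ℂ) a * t‖ :=
      norm_pos_iff.2 (one_sub_conj_mul_ne_zero ha1 hz₀)
    have h3 : ‖1 - (starRingEnd ℂ) a * t‖ ^ 2 ≤ 4 := by
      nlinarith [norm_one_sub_conj_mul_le ha1 hz₀]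
    have h4 : 1 - R ^ 2 ≤ 1 - ‖a‖ ^ 2 := by nlinarith [norm_nonneg a]
    have : q ≤ (1 - ‖a‖ ^ 2) * (1 - t ^ 2) / ‖1 - (starRingEnd ℂ) a * t‖ ^ 2 := by
      rw [hq]
      gcongr
      nlinarith
    linarith
  have hρ1 : √(1 - q) < 1 := by
    rw [Real.sqrt_lt' one_pos]; linarith
  have hρ0 : 0 < √(1 - q) := Real.sqrt_pos.2 (by linarith)
  obtain ⟨N, hN⟩ := exists_pow_lt_of_lt_one hBt hρ1
  obtain ⟨m, c, a, hc, ha, h⟩ := exists_eq_prod_blaschkeFactor hz₀ hρ0 hρ N B hB hlim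
    (fun z hz hBz => by
      by_contra hlt
      have := hr0 z ((le_max_left _ _).trans_lt (not_le.1 hlt)) hz
      simp [hBz] at this) hN
  refine ⟨m, c, a, Nat.one_le_iff_ne_zero.2 ?_, hc, ha, h⟩
  rintro rfl
  have h0 := hB1 0 (by simp)
  rw [h 0 (by simp)] at h0
  simp [hc] at h0

/-! ### Polynomial families over the polydisc and propagation of boundary roots. -/

lemma polydisc_eq_ball (n : ℕ) : polydisc n = ball 0 1 := by
  ext z
  simp [polydisc, pi_norm_lt_iff zero_lt_one]

lemma isOpen_polydisc (n : ℕ) : IsOpen (polydisc n) := polydisc_eq_ball n ▸ isOpen_ball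

lemma zero_mem_polydisc (n : ℕ) : (0 : Fin n → ℂ) ∈ polydisc n := fun j => by simp

lemma update_mem_polydisc {n : ℕ} {μ : Fin n → ℂ} (hμ : μ ∈ polydisc n) (i : Fin n) {z : ℂ}
    (hz : ‖z‖ < 1) : Function.update μ i z ∈ polydisc n := by
  intro j
  rcases eq_or_ne j i with rfl | h
  · simpa using hz
  · simpa [h] using hμ j

/-- A holomorphic family over the polydisc of monic polynomials of degree `N` with all roots in
the unit disc, having a root close to the unit circle whenever one variable approaches the circle
and the others vanish. -/
structure IsProperFamily (n N : ℕ) (P : (Fin n → ℂ) → ℂ[X]) : Prop where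
  monic : ∀ μ ∈ polydisc n, (P μ).Monic
  natDegree_eq : ∀ μ ∈ polydisc n, (P μ).natDegree = N
  differentiableOn : ∀ k, DifferentiableOn ℂ (fun μ => (P μ).coeff k) (polydisc n)
  norm_lt_one : ∀ μ ∈ polydisc n, ∀ w, (P μ).IsRoot w → ‖w‖ < 1
  exists_root : ∀ i, ∃ W : ℂ → ℂ, Tendsto (fun z => ‖W z‖) unitCircleFilter (𝓝 1) ∧
    ∀ᶠ z in unitCircleFilter, (P (Function.update 0 i z)).IsRoot (W z)

lemma Polynomial.eval_eq_prod_roots_sub {p : ℂ[X]} (hp : p.Monic) (x : ℂ) :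
    p.eval x = (p.roots.map (fun r => x - r)).prod := by
  conv_lhs => rw [(IsAlgClosed.splits p).eq_prod_roots_of_monic hp]
  rw [eval_multiset_prod, Multiset.map_map]
  simp

lemma Multiset.norm_prod_map_sub_le {s : Multiset ℂ} (hs : ∀ r ∈ s, ‖r‖ ≤ 1) {x : ℂ}
    (hx : ‖x‖ ≤ 1) : ‖(s.map (fun r => x - r)).prod‖ ≤ 2 ^ s.card := by
  induction s using Multiset.induction with
  | empty => simp
  | cons a s ih =>
    simp only [Multiset.mem_cons, forall_eq_or_imp] at hs
    rw [Multiset.map_cons, Multiset.prod_cons, norm_mul, Multiset.card_cons, pow_succ']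
    gcongr
    · linarith [norm_sub_le x a, hs.1]
    · exact ih hs.2

lemma Multiset.norm_prod_map_sub_sub_prod_map_sub_le {s : Multiset ℂ} (hs : ∀ r ∈ s, ‖r‖ ≤ 1)
    {x y : ℂ} (hx : ‖x‖ ≤ 1) (hy : ‖y‖ ≤ 1) :
    ‖(s.map (fun r => x - r)).prod - (s.map (fun r => y - r)).prod‖ ≤
      s.card * 2 ^ s.card * ‖x - y‖ := by
  induction s using Multiset.induction with
  | empty => simp
  | cons a s ih =>
    simp only [Multiset.mem_cons, forall_eq_or_imp] at hs
    rw [Multiset.map_cons, Multiset.prod_cons, Multiset.map_cons, Multiset.prod_cons,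
      Multiset.card_cons]
    set p := (s.map (fun r => x - r)).prod
    set q := (s.map (fun r => y - r)).prod
    have h1 : (x - a) * p - (y - a) * q = (x - y) * p + (y - a) * (p - q) := by ring
    have h2 : ‖y - a‖ ≤ 2 := by linarith [norm_sub_le y a, hs.1]
    have h3 : ‖p‖ ≤ 2 ^ s.card := norm_prod_map_sub_le hs.2 hx
    have h4 := ih hs.2
    rw [h1]
    refine (norm_add_le _ _).trans ?_
    rw [norm_mul, norm_mul]
    have h5 : ‖x - y‖ * ‖p‖ ≤ ‖x - y‖ * 2 ^ s.card := by gcongr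
    have h6 : ‖y - a‖ * ‖p - q‖ ≤ 2 * (s.card * 2 ^ s.card * ‖x - y‖) := by gcongr
    have h7 : (0 : ℝ) ≤ ‖x - y‖ * 2 ^ s.card := by positivity
    push_cast
    rw [pow_succ]
    nlinarith

namespace IsProperFamily

variable {n N : ℕ} {P : (Fin n → ℂ) → ℂ[X]}

lemma eval_eq_sum (hP : IsProperFamily n N P) {μ : Fin n → ℂ} (hμ : μ ∈ polydisc n) (w : ℂ) :
    (P μ).eval w = ∑ k ∈ Finset.range (N + 1), (P μ).coeff k * w ^ k := by
  rw [eval_eq_sum_range, hP.natDegree_eq μ hμ]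

lemma differentiableOn_eval (hP : IsProperFamily n N P) (w : ℂ) :
    DifferentiableOn ℂ (fun μ => (P μ).eval w) (polydisc n) := by
  have : DifferentiableOn ℂ (fun μ => ∑ k ∈ Finset.range (N + 1), (P μ).coeff k * w ^ k)
      (polydisc n) :=
    DifferentiableOn.fun_sum fun k _ => (hP.differentiableOn k).mul_const _
  exact this.congr fun μ hμ => hP.eval_eq_sum hμ w

lemma norm_root_le (hP : IsProperFamily n N P) {μ : Fin n → ℂ} (hμ : μ ∈ polydisc n) :
    ∀ r ∈ (P μ).roots, ‖r‖ ≤ 1 := fun r hr =>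
  (hP.norm_lt_one μ hμ r (isRoot_of_mem_roots hr)).le

lemma card_roots (hP : IsProperFamily n N P) {μ : Fin n → ℂ} (hμ : μ ∈ polydisc n) :
    (P μ).roots.card = N := by
  rw [← hP.natDegree_eq μ hμ, splits_iff_card_roots.1 (IsAlgClosed.splits _)]

lemma norm_eval_le (hP : IsProperFamily n N P) {μ : Fin n → ℂ} (hμ : μ ∈ polydisc n) {w : ℂ}
    (hw : ‖w‖ ≤ 1) : ‖(P μ).eval w‖ ≤ 2 ^ N := by
  rw [eval_eq_prod_roots_sub (hP.monic μ hμ), ← hP.card_roots hμ]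
  exact Multiset.norm_prod_map_sub_le (hP.norm_root_le hμ) hw

lemma norm_eval_sub_eval_le (hP : IsProperFamily n N P) {μ : Fin n → ℂ} (hμ : μ ∈ polydisc n)
    {x y : ℂ} (hx : ‖x‖ ≤ 1) (hy : ‖y‖ ≤ 1) :
    ‖(P μ).eval x - (P μ).eval y‖ ≤ N * 2 ^ N * ‖x - y‖ := by
  rw [eval_eq_prod_roots_sub (hP.monic μ hμ), eval_eq_prod_roots_sub (hP.monic μ hμ),
    ← hP.card_roots hμ]
  exact Multiset.norm_prod_map_sub_sub_prod_map_sub_le (hP.norm_root_le hμ) hx hy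

/-- Values at a unimodular point are controlled by the value over the centre of the polydisc. -/
lemma exists_norm_eval_le_rpow (hP : IsProperFamily n N P) (i : Fin n) {μ : Fin n → ℂ}
    (hμ : μ ∈ polydisc n) : ∃ κ > (0 : ℝ), ∀ z, ‖z‖ < 1 → ∀ c, ‖c‖ = 1 →
      ‖(P (Function.update μ i z)).eval c‖ ≤
        2 ^ N * (‖(P (Function.update 0 i z)).eval c‖ / 2 ^ N) ^ κ := by
  have hμ1 : ‖μ‖ < 1 := by simpa [polydisc_eq_ball] using hμ
  have hpos : 0 < 1 + ‖μ‖ := by positivity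
  -- With this radius the disc |ζ| < R, R > 1, is sent into the polydisc by ζ ↦ ζμ. It depends on μ
  -- alone, hence so does κ.
  set R : ℝ := 2 / (1 + ‖μ‖) with hR
  have hR1 : 1 < R := by rw [hR, lt_div_iff₀ hpos]; linarith
  have hRμ : R * ‖μ‖ ≤ 1 := by
    rw [hR, div_mul_eq_mul_div, div_le_one hpos]; linarith
  refine ⟨(R - 1) / (R + 1), div_pos (by linarith) (by linarith), fun z hz c hc => ?_⟩
  set φ : ℂ → Fin n → ℂ := fun ζ => Function.update (ζ • μ) i z with hφ
  have hφmem : ∀ ζ ∈ ball (0 : ℂ) R, φ ζ ∈ polydisc n := by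
    intro ζ hζ
    refine update_mem_polydisc ?_ i hz
    rw [polydisc_eq_ball, mem_ball_zero_iff, norm_smul]
    have hζ' : ‖ζ‖ < R := by simpa using hζ
    rcases (norm_nonneg μ).eq_or_lt with h | h
    · rw [← h, mul_zero]; exact one_pos
    · nlinarith
  have hφd : DifferentiableOn ℂ φ (ball 0 R) := by
    refine differentiableOn_pi.2 fun j => ?_
    rcases eq_or_ne j i with rfl | h
    · simp [hφ]
    · simp only [hφ, Function.update_of_ne h, Pi.smul_apply, smul_eq_mul]
      fun_prop
  have h2 : (2 : ℂ) ^ N ≠ 0 := pow_ne_zero _ two_ne_zero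
  have key := norm_le_rpow_of_ne_zero (g := fun ζ => (P (φ ζ)).eval c / 2 ^ N) hR1
    (((hP.differentiableOn_eval c).comp hφd hφmem).div_const _)
    (fun ζ hζ => div_ne_zero (fun h => ?_) h2) (fun ζ hζ => ?_)
  · simp only [hφ, one_smul, zero_smul, norm_div, norm_pow, RCLike.norm_ofNat] at key
    rw [div_le_iff₀ (by positivity), mul_comm] at key
    exact key
  · exact (hP.norm_lt_one _ (hφmem ζ hζ) c h).ne hc
  · rw [norm_div, norm_pow, RCLike.norm_ofNat]
    exact div_le_one_of_le₀ (hP.norm_eval_le (hφmem ζ hζ) hc.le) (by positivity)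

/-- Harnack's inequality is available only at unimodular points, so W(z) is replaced by its radial
projection c. The Lipschitz bound, uniform in μ, makes the cost of moving between W(z) and c a
multiple of 1 - |W(z)|. -/
lemma tendsto_eval_root (hP : IsProperFamily n N P) (i : Fin n) {W : ℂ → ℂ}
    (hW : Tendsto (fun z => ‖W z‖) unitCircleFilter (𝓝 1))
    (hroot : ∀ᶠ z in unitCircleFilter, (P (Function.update 0 i z)).IsRoot (W z))
    {μ : Fin n → ℂ} (hμ : μ ∈ polydisc n) :
    Tendsto (fun z => (P (Function.update μ i z)).eval (W z)) unitCircleFilter (𝓝 0) := by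
  obtain ⟨κ, hκ, H⟩ := hP.exists_norm_eval_le_rpow i hμ
  have hd : Tendsto (fun z => 1 - ‖W z‖) unitCircleFilter (𝓝 0) := by
    simpa using hW.const_sub 1
  have hb : Tendsto (fun z => 2 ^ N * ((N * 2 ^ N * (1 - ‖W z‖)) / 2 ^ N) ^ κ +
      N * 2 ^ N * (1 - ‖W z‖)) unitCircleFilter (𝓝 0) := by
    have h1 := (((hd.const_mul (N * 2 ^ N : ℝ)).div_const (2 ^ N)).rpow_const
      (p := κ) (Or.inr hκ.le)).const_mul ((2 : ℝ) ^ N) |>.add (hd.const_mul (N * 2 ^ N : ℝ))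
    simpa [Real.zero_rpow hκ.ne'] using h1
  refine squeeze_zero_norm' ?_ hb
  filter_upwards [eventually_norm_lt_one, hroot, hW.eventually (lt_mem_nhds (zero_lt_one' ℝ))]
    with z hz hzr hWpos
  have m0 := update_mem_polydisc (zero_mem_polydisc n) i hz
  have mμ := update_mem_polydisc hμ i hz
  have hW1 : ‖W z‖ < 1 := hP.norm_lt_one _ m0 _ hzr
  set c : ℂ := W z / ‖W z‖ with hc
  have hc1 : ‖c‖ = 1 := by
    rw [hc, norm_div, norm_real, norm_norm, div_self hWpos.ne']
  have hdist : ‖c - W z‖ = 1 - ‖W z‖ := by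
    have : c - W z = c * ((1 - ‖W z‖ : ℝ) : ℂ) := by
      have h0 : (‖W z‖ : ℂ) ≠ 0 := by exact_mod_cast hWpos.ne'
      rw [hc]
      push_cast
      field_simp
    rw [this, norm_mul, hc1, one_mul, norm_real, Real.norm_of_nonneg (by linarith)]
  have e0 : ‖(P (Function.update 0 i z)).eval c‖ ≤ N * 2 ^ N * (1 - ‖W z‖) := by
    have := hP.norm_eval_sub_eval_le m0 hc1.le hW1.le
    rwa [hzr.eq_zero, sub_zero, hdist] at this
  have e1 := hP.norm_eval_sub_eval_le mμ hW1.le hc1.le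
  rw [norm_sub_rev (W z), hdist] at e1
  have e2 := H z hz c hc1
  calc ‖(P (Function.update μ i z)).eval (W z)‖
      ≤ ‖(P (Function.update μ i z)).eval c‖ + ‖(P (Function.update μ i z)).eval (W z) -
          (P (Function.update μ i z)).eval c‖ := by
        simpa using norm_add_le ((P (Function.update μ i z)).eval c)
          ((P (Function.update μ i z)).eval (W z) - (P (Function.update μ i z)).eval c)
    _ ≤ _ := by
        refine add_le_add (e2.trans ?_) e1
        gcongr

end IsProperFamily

/-! ### Resultants and common roots. -/

lemma differentiableOn_update {n : ℕ} (μ : Fin n → ℂ) (i : Fin n) (s : Set ℂ) :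
    DifferentiableOn ℂ (fun z => Function.update μ i z) s := by
  refine differentiableOn_pi.2 fun j => ?_
  rcases eq_or_ne j i with rfl | h
  · simp only [Function.update_self]
    exact differentiableOn_id
  · simp [h]

/-- The resultant depends holomorphically on the coefficients. -/
lemma DifferentiableOn.resultant {f g : ℂ → ℂ[X]} {s : Set ℂ}
    (hf : ∀ k, DifferentiableOn ℂ (fun z => (f z).coeff k) s)
    (hg : ∀ k, DifferentiableOn ℂ (fun z => (g z).coeff k) s) (m n : ℕ) :
    DifferentiableOn ℂ (fun z => (f z).resultant (g z) m n) s := by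
  simp only [Polynomial.resultant, Matrix.det_apply']
  refine DifferentiableOn.fun_sum fun σ _ => DifferentiableOn.const_mul ?_ _
  refine DifferentiableOn.fun_finsetProd fun j _ => ?_
  simp only [sylvester, Matrix.of_apply]
  induction j using Fin.addCases with
  | left j =>
    simp only [Fin.addCases_left]
    split_ifs
    · exact hg _
    · exact differentiableOn_const _
  | right j =>
    simp only [Fin.addCases_right]
    split_ifs
    · exact hf _
    · exact differentiableOn_const _

lemma Multiset.norm_prod_map_le_of_mem {s : Multiset ℂ} {f : ℂ → ℂ} {C : ℝ} (hC : 1 ≤ C)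
    (hf : ∀ r ∈ s, ‖f r‖ ≤ C) {w : ℂ} (hw : w ∈ s) :
    ‖(s.map f).prod‖ ≤ ‖f w‖ * C ^ s.card := by
  obtain ⟨t, rfl⟩ := Multiset.exists_cons_of_mem hw
  have key : ∀ t : Multiset ℂ, (∀ r ∈ t, ‖f r‖ ≤ C) → ‖(t.map f).prod‖ ≤ C ^ t.card := by
    intro t ht
    induction t using Multiset.induction with
    | empty => simp
    | cons a t ih =>
      simp only [Multiset.mem_cons, forall_eq_or_imp] at ht
      rw [Multiset.map_cons, Multiset.prod_cons, norm_mul, Multiset.card_cons, pow_succ']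
      exact mul_le_mul ht.1 (ih fun r hr => ht.2 r hr) (norm_nonneg _) (by linarith)
  rw [Multiset.map_cons, Multiset.prod_cons, norm_mul, Multiset.card_cons]
  refine mul_le_mul_of_nonneg_left ?_ (norm_nonneg _)
  exact (key t fun r hr => hf r (Multiset.mem_cons_of_mem hr)).trans
    (pow_le_pow_right₀ hC (Nat.le_succ _))

namespace IsProperFamily

variable {n N : ℕ} {P : (Fin n → ℂ) → ℂ[X]}

/-- With one variable fixed, all members of the family have a root in common. -/
theorem exists_common_root (hP : IsProperFamily n N P) (i : Fin n) {z : ℂ} (hz : ‖z‖ < 1) :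
    ∃ w, ∀ μ ∈ polydisc n, (P (Function.update μ i z)).IsRoot w := by
  set p : polydisc n → ℂ → ℂ[X] := fun μ z => P (Function.update μ i z) with hp
  set p₀ : ℂ → ℂ[X] := fun z => P (Function.update 0 i z) with hp₀
  have mem : ∀ (μ : polydisc n) {z : ℂ}, ‖z‖ < 1 → Function.update (μ : Fin n → ℂ) i z ∈
    polydisc n := fun μ z hz => update_mem_polydisc μ.2 i hz
  have mem₀ : ∀ {z : ℂ}, ‖z‖ < 1 → Function.update (0 : Fin n → ℂ) i z ∈ polydisc n :=
    fun hz => update_mem_polydisc (zero_mem_polydisc n) i hz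
  set S : (polydisc n →₀ ℂ) → ℂ → ℂ[X] :=
    fun t z => Finsupp.linearCombination ℂ (fun μ => p μ z) t with hS
  have Seq : ∀ t z, S t z = ∑ μ ∈ t.support, t μ • p μ z := fun t z => by
    simp [hS, Finsupp.linearCombination_apply, Finsupp.sum]
  have Seval : ∀ t z w, (S t z).eval w = ∑ μ ∈ t.support, t μ * (p μ z).eval w := fun t z w => by
    simp [Seq, eval_finsetSum]
  have hcoeff : ∀ (μ : Fin n → ℂ), μ ∈ polydisc n → ∀ k,
      DifferentiableOn ℂ (fun z => (P (Function.update μ i z)).coeff k) (ball 0 1) :=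
    fun μ hμ k => (hP.differentiableOn k).comp (differentiableOn_update μ i _)
      fun z hz => update_mem_polydisc hμ i (by simpa using hz)
  have Sdeg : ∀ t z, ‖z‖ < 1 → (S t z).natDegree ≤ N := by
    intro t z hz
    rw [Seq]
    refine natDegree_sum_le_of_forall_le _ _ fun μ _ => (natDegree_smul_le _ _).trans ?_
    exact (hP.natDegree_eq _ (mem μ hz)).le
  have hres : ∀ t z, ‖z‖ < 1 →
      (p₀ z).resultant (S t z) N N = ((p₀ z).roots.map (S t z).eval).prod := by
    intro t z hz
    have := resultant_eq_prod_eval (p₀ z) (S t z) N (Sdeg t z hz) (IsAlgClosed.splits _)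
    rwa [hP.natDegree_eq _ (mem₀ hz), (hP.monic _ (mem₀ hz)).leadingCoeff, one_pow,
      one_mul] at this
  -- Near the circle the factor of the resultant at the root W tends to 0 and the remaining factors
  -- are bounded by `C`. The resultant is holomorphic in z, hence zero.
  have hzero : ∀ t, (p₀ z).resultant (S t z) N N = 0 := by
    intro t
    refine eq_zero_of_tendsto_zero (h := fun z => (p₀ z).resultant (S t z) N N) ?_ ?_ hz
    · refine DifferentiableOn.resultant (hcoeff 0 (zero_mem_polydisc n)) (fun k => ?_) N N
      simp only [Seq, finsetSum_coeff, coeff_smul, smul_eq_mul]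
      exact DifferentiableOn.fun_sum fun μ _ => (hcoeff μ μ.2 k).const_mul _
    · obtain ⟨W, hW, hroot⟩ := hP.exists_root i
      set C : ℝ := 1 + ∑ μ ∈ t.support, ‖t μ‖ * 2 ^ N with hC
      have hC1 : 1 ≤ C := by
        rw [hC]
        have : 0 ≤ ∑ μ ∈ t.support, ‖t μ‖ * (2 : ℝ) ^ N := by positivity
        linarith
      have hSW : Tendsto (fun z => (S t z).eval (W z)) unitCircleFilter (𝓝 0) := by
        simp only [Seval]
        have := tendsto_finsetSum t.support fun μ _ =>
          (hP.tendsto_eval_root i hW hroot μ.2).const_mul (t μ)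
        simpa using this
      have hlim : Tendsto (fun z => ‖(S t z).eval (W z)‖ * C ^ N) unitCircleFilter (𝓝 0) := by
        simpa using hSW.norm.mul_const (C ^ N)
      refine squeeze_zero_norm' ?_ hlim
      filter_upwards [eventually_norm_lt_one, hroot] with x hx hxr
      rw [hres t x hx, ← hP.card_roots (mem₀ hx)]
      refine Multiset.norm_prod_map_le_of_mem hC1 (fun r hr => ?_)
        ((mem_roots (hP.monic _ (mem₀ hx)).ne_zero).2 hxr)
      rw [Seval]
      refine (norm_sum_le _ _).trans ?_
      rw [hC]
      refine le_add_of_nonneg_of_le zero_le_one (Finset.sum_le_sum fun μ _ => ?_)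
      rw [norm_mul]
      gcongr
      exact hP.norm_eval_le (mem μ hx) (hP.norm_root_le (mem₀ hx) r hr)
  -- `V r` consists of the coefficient vectors whose combination vanishes at r. These finitely many
  -- subspaces cover the space, so one of them is everything; testing it on basis vectors shows that
  -- r is a common root.
  set V : (p₀ z).roots.toFinset → Submodule ℂ (polydisc n →₀ ℂ) := fun r =>
    LinearMap.ker (Finsupp.linearCombination ℂ (fun μ => (p μ z).eval (r : ℂ))) with hV
  have hcover : ⋃ r, (V r : Set (polydisc n →₀ ℂ)) = Set.univ := by
    refine eq_univ_of_forall fun t => ?_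
    have h := hzero t
    rw [hres t z hz, Multiset.prod_eq_zero_iff, Multiset.mem_map] at h
    obtain ⟨r, hr, hr0⟩ := h
    refine mem_iUnion.2 ⟨⟨r, Multiset.mem_toFinset.2 hr⟩, ?_⟩
    rw [SetLike.mem_coe, LinearMap.mem_ker, Finsupp.linearCombination_apply, Finsupp.sum]
    simpa [Seval] using hr0
  obtain ⟨r, hr⟩ := Subspace.exists_eq_top_of_iUnion_eq_univ hcover
  refine ⟨r, fun μ hμ => ?_⟩
  have : Finsupp.single ⟨μ, hμ⟩ (1 : ℂ) ∈ V r := hr ▸ Submodule.mem_top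
  simpa [hV] using this

end IsProperFamily

/-! ### Separating the common roots and splitting into one-variable factors. -/

namespace IsProperFamily

variable {n N : ℕ} {P : (Fin n → ℂ) → ℂ[X]}

/-- By the identity theorem, if x were a root for parameters z accumulating at z₀, the value at x
would vanish along the whole slice through μ, including at μ itself. -/
lemma eventually_exists_not_isRoot (hP : IsProperFamily n N P) {x : ℂ}
    (hx : ∃ μ ∈ polydisc n, ¬ (P μ).IsRoot x) (i : Fin n) {z₀ : ℂ} (hz₀ : ‖z₀‖ < 1) :
    ∀ᶠ z in 𝓝[≠] z₀, ∃ μ ∈ polydisc n, ¬ (P (Function.update μ i z)).IsRoot x := by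
  obtain ⟨μ, hμ, hne⟩ := hx
  have hd : DifferentiableOn ℂ (fun z => (P (Function.update μ i z)).eval x) (ball 0 1) :=
    (hP.differentiableOn_eval x).comp (differentiableOn_update μ i _)
      fun z hz => update_mem_polydisc hμ i (by simpa using hz)
  by_contra hcon
  rw [not_eventually] at hcon
  have h0 := (hd.analyticOnNhd isOpen_ball).eqOn_zero_of_preconnected_of_frequently_eq_zero
    (convex_ball (0 : ℂ) 1).isPreconnected (by simpa using hz₀)
    (hcon.mono fun z hz => by
      push Not at hz
      exact hz μ hμ)
  apply hne
  simpa using h0 (show μ i ∈ ball (0 : ℂ) 1 by simpa using hμ i)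

/-- Common roots belonging to different variables can be made distinct by moving the variables. -/
lemma exists_injOn_root (hP : IsProperFamily n N P)
    (hnc : ∀ x, ∃ μ ∈ polydisc n, ¬ (P μ).IsRoot x) {b : Fin n → ℂ → ℂ}
    (hb : ∀ i z, ‖z‖ < 1 → ∀ μ ∈ polydisc n, (P (Function.update μ i z)).IsRoot (b i z))
    {U : Set (Fin n → ℂ)} (hU : IsOpen U) (hUD : U ⊆ polydisc n) {μ : Fin n → ℂ} (hμ : μ ∈ U)
    (S : Finset ℂ) (J : Finset (Fin n)) :
    ∃ ν ∈ U, (∀ j ∉ J, ν j = μ j) ∧ (∀ j ∈ J, b j (ν j) ∉ S) ∧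
      Set.InjOn (fun j => b j (ν j)) J := by
  classical
  induction J using Finset.induction with
  | empty => exact ⟨μ, hμ, by simp⟩
  | insert j J hj ih =>
    obtain ⟨ν, hν, hoff, hS, hinj⟩ := ih
    have hc : ContinuousAt (fun z => Function.update ν j z) (ν j) := by fun_prop
    have h1 : ∀ᶠ z in 𝓝[≠] (ν j), Function.update ν j z ∈ U :=
      (hc.eventually (hU.mem_nhds (by simpa using hν))).filter_mono nhdsWithin_le_nhds
    -- Only finitely many values are forbidden: those in `S` and the roots already chosen. None of
    -- them is a common root for z close to, but different from, the current coordinate.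
    have h2 : ∀ᶠ z in 𝓝[≠] (ν j), ∀ x ∈ S ∪ J.image (fun k => b k (ν k)),
        ∃ κ ∈ polydisc n, ¬ (P (Function.update κ j z)).IsRoot x :=
      (Finset.eventually_all _).2 fun x _ =>
        hP.eventually_exists_not_isRoot (hnc x) j (hUD hν j)
    obtain ⟨z, hzU, hz⟩ := (h1.and h2).exists
    have hz1 : ‖z‖ < 1 := by simpa using hUD hzU j
    have hbz : b j z ∉ S ∪ J.image (fun k => b k (ν k)) := fun hmem => by
      obtain ⟨κ, hκ, hne⟩ := hz _ hmem
      exact hne (hb j z hz1 κ hκ)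
    rw [Finset.mem_union, not_or, Finset.mem_image] at hbz
    have hupd : ∀ k ∈ J, Function.update ν j z k = ν k := fun k hk =>
      Function.update_of_ne (fun h : k = j => hj (h ▸ hk)) _ _
    refine ⟨Function.update ν j z, hzU, fun k hk => ?_, fun k hk => ?_, ?_⟩
    · rw [Finset.mem_insert, not_or] at hk
      rw [Function.update_of_ne hk.1, hoff k hk.2]
    · rcases Finset.mem_insert.1 hk with rfl | hk
      · simpa using hbz.1
      · rw [hupd k hk]
        exact hS k hk
    · rw [Finset.coe_insert, Set.injOn_insert (by simpa using hj)]
      refine ⟨fun k hk l hl hkl => hinj hk hl ?_, ?_⟩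
      · simpa only [hupd k hk, hupd l hl] using hkl
      · rintro ⟨k, hk, hkj⟩
        refine hbz.2 ⟨k, hk, ?_⟩
        simpa only [hupd k hk, Function.update_self] using hkj

lemma isRoot_apply {b : Fin n → ℂ → ℂ}
    (hb : ∀ i z, ‖z‖ < 1 → ∀ μ ∈ polydisc n, (P (Function.update μ i z)).IsRoot (b i z))
    {μ : Fin n → ℂ} (hμ : μ ∈ polydisc n) (i : Fin n) : (P μ).IsRoot (b i (μ i)) := by
  simpa using hb i (μ i) (hμ i) μ hμ

lemma map_le_roots (hP : IsProperFamily n N P) {b : Fin n → ℂ → ℂ}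
    (hb : ∀ i z, ‖z‖ < 1 → ∀ μ ∈ polydisc n, (P (Function.update μ i z)).IsRoot (b i z))
    {μ : Fin n → ℂ} (hμ : μ ∈ polydisc n) (hinj : Function.Injective fun j => b j (μ j)) :
    (Finset.univ : Finset (Fin n)).val.map (fun j => b j (μ j)) ≤ (P μ).roots := by
  rw [Multiset.le_iff_subset (Finset.univ.nodup.map hinj)]
  intro x hx
  obtain ⟨j, -, rfl⟩ := Multiset.mem_map.1 hx
  exact (mem_roots (hP.monic μ hμ).ne_zero).2 (isRoot_apply hb hμ j)

lemma exists_root_functions (hP : IsProperFamily n N P) : ∃ b : Fin n → ℂ → ℂ,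
    ∀ i z, ‖z‖ < 1 → ∀ μ ∈ polydisc n, (P (Function.update μ i z)).IsRoot (b i z) := by
  have : ∀ (i : Fin n) (z : ℂ), ∃ w, ‖z‖ < 1 → ∀ μ ∈ polydisc n,
      (P (Function.update μ i z)).IsRoot w := fun i z => by
    by_cases hz : ‖z‖ < 1
    · obtain ⟨w, hw⟩ := hP.exists_common_root i hz
      exact ⟨w, fun _ => hw⟩
    · exact ⟨0, fun h => absurd h hz⟩
  choose b hb using this
  exact ⟨b, hb⟩

lemma le_of_no_constant_root (hP : IsProperFamily n N P)
    (hnc : ∀ x, ∃ μ ∈ polydisc n, ¬ (P μ).IsRoot x) : n ≤ N := by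
  obtain ⟨b, hb⟩ := hP.exists_root_functions
  obtain ⟨ν, hν, -, -, hinj⟩ := hP.exists_injOn_root hnc hb (isOpen_polydisc n) Subset.rfl
    (zero_mem_polydisc n) ∅ Finset.univ
  have := Multiset.card_le_card (hP.map_le_roots hb hν
    (by simpa [← Set.injOn_univ] using hinj))
  simpa [hP.card_roots hν] using this

/-- A constant root can be divided out. -/
lemma divByMonic (hP : IsProperFamily n N P) {a : ℂ} (ha : ∀ μ ∈ polydisc n, (P μ).IsRoot a) :
    IsProperFamily n (N - 1) (fun μ => P μ /ₘ (X - C a)) := by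
  have ha1 : ‖a‖ < 1 := hP.norm_lt_one 0 (zero_mem_polydisc n) a (ha 0 (zero_mem_polydisc n))
  have hmul : ∀ μ ∈ polydisc n, (X - C a) * (P μ /ₘ (X - C a)) = P μ := fun μ hμ =>
    mul_divByMonic_eq_iff_isRoot.2 (ha μ hμ)
  refine ⟨fun μ hμ => ?_, fun μ hμ => ?_, fun k => ?_, fun μ hμ w hw => ?_, fun i => ?_⟩
  · exact (monic_X_sub_C a).of_mul_monic_left ((hmul μ hμ).symm ▸ hP.monic μ hμ)
  · rw [natDegree_divByMonic _ (monic_X_sub_C a), hP.natDegree_eq μ hμ, natDegree_X_sub_C]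
  · have : DifferentiableOn ℂ (fun μ => ∑ i ∈ Finset.Icc (k + 1) N, a ^ (i - (k + 1)) *
        (P μ).coeff i) (polydisc n) :=
      DifferentiableOn.fun_sum fun i _ => (hP.differentiableOn i).const_mul _
    refine this.congr fun μ hμ => ?_
    rw [coeff_divByMonic_X_sub_C, hP.natDegree_eq μ hμ]
  · refine hP.norm_lt_one μ hμ w ?_
    rw [← hmul μ hμ]
    exact root_mul_left_of_isRoot _ hw
  · obtain ⟨W, hW, hroot⟩ := hP.exists_root i
    refine ⟨W, hW, ?_⟩
    filter_upwards [hroot, eventually_norm_lt_one, hW.eventually (lt_mem_nhds ha1)]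
      with z hz hz1 hWa
    rw [← hmul _ (update_mem_polydisc (zero_mem_polydisc n) i hz1), root_mul] at hz
    -- Near the circle |W(z)| exceeds |a|, so the boundary root survives the division.
    refine hz.resolve_left fun h => ?_
    rw [root_X_sub_C] at h
    exact hWa.ne (by rw [h])

/-- Constant roots are divided out until none is left; then n distinct roots coexist in one member.
Degree 0 is treated apart because of the truncated `N - 1`: the constant polynomial 1 has no root.
-/
theorem le_natDegree (hP : IsProperFamily n N P) : n ≤ N := by
  induction N using Nat.strong_induction_on generalizing P with
  | _ N ih =>
    by_cases hnc : ∀ x, ∃ μ ∈ polydisc n, ¬ (P μ).IsRoot x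
    · exact hP.le_of_no_constant_root hnc
    · push Not at hnc
      obtain ⟨a, ha⟩ := hnc
      rcases Nat.eq_zero_or_pos N with rfl | hN
      · exfalso
        have h0 := zero_mem_polydisc n
        have h1 := ((hP.monic 0 h0 : (P 0).Monic).natDegree_eq_zero).1 (hP.natDegree_eq 0 h0)
        have h2 := ha 0 h0
        simp [h1] at h2
      · exact (ih (N - 1) (by omega) (hP.divByMonic ha)).trans (Nat.sub_le _ _)

lemma exists_not_isRoot (hP : IsProperFamily n n P) (hn : 1 ≤ n) (x : ℂ) :
    ∃ μ ∈ polydisc n, ¬ (P μ).IsRoot x := by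
  by_contra h
  push Not at h
  have := (hP.divByMonic h).le_natDegree
  omega

lemma eq_prod_of_injective (hP : IsProperFamily n n P) {b : Fin n → ℂ → ℂ}
    (hb : ∀ i z, ‖z‖ < 1 → ∀ μ ∈ polydisc n, (P (Function.update μ i z)).IsRoot (b i z))
    {μ : Fin n → ℂ} (hμ : μ ∈ polydisc n) (hinj : Function.Injective fun j => b j (μ j)) :
    P μ = ∏ j, (X - C (b j (μ j))) := by
  have h := Multiset.eq_of_le_of_card_le (hP.map_le_roots hb hμ hinj)
    (by simp [hP.card_roots hμ])
  rw [(IsAlgClosed.splits (P μ)).eq_prod_roots_of_monic (hP.monic μ hμ), ← h, Multiset.map_map]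
  rfl

/-- Once the other roots are frozen and distinct from b_i(z) near z₀, Vieta's formula for the
coefficient of degree n - 1 expresses b_i(z) as a holomorphic function minus a constant. -/
lemma differentiableOn_root (hP : IsProperFamily n n P) (hn : 1 ≤ n) {b : Fin n → ℂ → ℂ}
    (hb : ∀ i z, ‖z‖ < 1 → ∀ μ ∈ polydisc n, (P (Function.update μ i z)).IsRoot (b i z))
    (i : Fin n) : DifferentiableOn ℂ (b i) (ball 0 1) := by
  intro z₀ hz₀
  have hz₀' : ‖z₀‖ < 1 := by simpa using hz₀
  have m0 := update_mem_polydisc (zero_mem_polydisc n) i hz₀'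
  obtain ⟨ν, hν, hoff, hS, hinj⟩ := hP.exists_injOn_root (hP.exists_not_isRoot hn) hb
    (isOpen_polydisc n) Subset.rfl m0 (P (Function.update 0 i z₀)).roots.toFinset
    (Finset.univ.erase i)
  have hball : ∀ᶠ z in 𝓝 z₀, z ∈ ball (0 : ℂ) 1 := isOpen_ball.mem_nhds hz₀
  have hne : ∀ᶠ z in 𝓝 z₀, ∀ j ∈ Finset.univ.erase i, b i z ≠ b j (ν j) := by
    -- Continuity of b_i is not yet known. Instead, b_j(ν_j) is not a root of the polynomial over
    -- the centre at z₀, hence not for nearby z either, whereas b_i(z) is one.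
    refine (Finset.eventually_all _).2 fun j hj => ?_
    have hd : DifferentiableOn ℂ
        (fun z => (P (Function.update 0 i z)).eval (b j (ν j))) (ball 0 1) :=
      (hP.differentiableOn_eval _).comp (differentiableOn_update 0 i _)
        fun z hz => update_mem_polydisc (zero_mem_polydisc n) i (by simpa using hz)
    have hj0 : (P (Function.update 0 i z₀)).eval (b j (ν j)) ≠ 0 := fun h =>
      hS j hj (Multiset.mem_toFinset.2 ((mem_roots (hP.monic _ m0).ne_zero).2 h))
    filter_upwards [(hd.continuousOn.continuousAt hball).eventually_ne hj0, hball] with z hz hz1 h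
    exact hz (h ▸ hb i z (by simpa using hz1) 0 (zero_mem_polydisc n))
  have hform : b i =ᶠ[𝓝 z₀] fun z => -(P (Function.update ν i z)).coeff (n - 1) -
      ∑ j ∈ Finset.univ.erase i, b j (ν j) := by
    filter_upwards [hne, hball] with z hz hz1
    have mz := update_mem_polydisc hν i (show ‖z‖ < 1 by simpa using hz1)
    have hupd : ∀ j ∈ Finset.univ.erase i, Function.update ν i z j = ν j := fun j hj =>
      Function.update_of_ne (Finset.ne_of_mem_erase hj) _ _
    have hinj' : Function.Injective fun j => b j (Function.update ν i z j) := by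
      have : Set.InjOn (fun j => b j (Function.update ν i z j))
          (insert i ((Finset.univ.erase i : Finset (Fin n)) : Set (Fin n))) := by
        rw [Set.injOn_insert (by simp)]
        refine ⟨fun k hk l hl hkl => hinj hk hl ?_, ?_⟩
        · simpa only [hupd k hk, hupd l hl] using hkl
        · rintro ⟨k, hk, hki⟩
          refine hz k hk ?_
          simpa only [hupd k hk, Function.update_self] using hki.symm
      rw [← Set.injOn_univ]
      refine this.mono fun k _ => ?_
      rw [← Finset.coe_insert, Finset.insert_erase (Finset.mem_univ i)]
      simp
    have hcoef := prod_X_sub_C_coeff_card_pred Finset.univ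
      (fun j => b j (Function.update ν i z j)) (by rwa [Finset.card_univ, Fintype.card_fin])
    rw [← hP.eq_prod_of_injective hb mz hinj', Finset.card_univ, Fintype.card_fin,
      ← Finset.add_sum_erase _ _ (Finset.mem_univ i), Function.update_self,
      Finset.sum_congr rfl fun j hj => by rw [hupd j hj]] at hcoef
    rw [hcoef]
    ring
  have hd : DifferentiableOn ℂ (fun z => -(P (Function.update ν i z)).coeff (n - 1) -
      ∑ j ∈ Finset.univ.erase i, b j (ν j)) (ball 0 1) :=
    (((hP.differentiableOn (n - 1)).comp (differentiableOn_update ν i _)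
      fun z hz => update_mem_polydisc hν i (by simpa using hz)).neg).sub_const _
  exact ((hd.differentiableAt hball).congr_of_eventuallyEq hform).differentiableWithinAt

/-- A proper family whose degree equals the number of variables splits into linear factors,
each of which depends on one variable only. -/
theorem exists_eq_prod (hP : IsProperFamily n n P) (hn : 1 ≤ n) : ∃ b : Fin n → ℂ → ℂ,
    (∀ i, DifferentiableOn ℂ (b i) (ball 0 1)) ∧
      ∀ μ ∈ polydisc n, P μ = ∏ j, (X - C (b j (μ j))) := by
  obtain ⟨b, hb⟩ := hP.exists_root_functions
  have hd := hP.differentiableOn_root hn hb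
  refine ⟨b, hd, fun μ hμ => Polynomial.funext fun w => ?_⟩
  by_contra hne
  have hc : ContinuousOn (fun ν => (P ν).eval w - (∏ j, (X - C (b j (ν j)))).eval w)
      (polydisc n) := by
    refine (hP.differentiableOn_eval w).continuousOn.sub ?_
    simp only [eval_prod, eval_sub, eval_X, eval_C]
    refine continuousOn_finsetProd _ fun j _ => continuousOn_const.sub ?_
    exact (hd j).continuousOn.comp (continuous_apply j).continuousOn
      fun ν hν => by simpa using hν j
  -- The identity at w fails on an open set; a point of that set with distinct roots contradicts the
  -- factorization there.
  obtain ⟨ν, hν, -, -, hinj⟩ := hP.exists_injOn_root (hP.exists_not_isRoot hn) hb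
    (hc.isOpen_inter_preimage (isOpen_polydisc n) isOpen_ne) inter_subset_left
    (show μ ∈ polydisc n ∩ _ ⁻¹' {x | x ≠ 0} from ⟨hμ, sub_ne_zero.2 hne⟩) ∅ Finset.univ
  refine hν.2 (sub_eq_zero.2 ?_)
  rw [hP.eq_prod_of_injective hb hν.1 (by simpa [← Set.injOn_univ] using hinj)]

end IsProperFamily

/-! ### Symmetrization and Vieta's formulas. -/

lemma monic_prod_X_sub {n : ℕ} (z : Fin n → ℂ) : (∏ j, (X - C (z j))).Monic :=
  monic_prod_of_monic _ _ fun _ _ => monic_X_sub_C _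

lemma natDegree_prod_X_sub {n : ℕ} (z : Fin n → ℂ) : (∏ j, (X - C (z j))).natDegree = n := by
  simp [natDegree_prod_of_monic _ _ fun j _ => monic_X_sub_C (z j)]

lemma isRoot_prod_X_sub {n : ℕ} {z : Fin n → ℂ} {w : ℂ} :
    (∏ j, (X - C (z j))).IsRoot w ↔ ∃ j, w = z j := by
  simp [IsRoot.def, eval_prod, Finset.prod_eq_zero_iff, sub_eq_zero]

lemma coeff_prod_X_sub {n : ℕ} (z : Fin n → ℂ) {k : ℕ} (hk : k < n) :
    (∏ j, (X - C (z j))).coeff k =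
      (-1) ^ (n - k) * symmetrization n z ⟨n - k - 1, by omega⟩ := by
  have h := Multiset.prod_X_sub_C_coeff ((Finset.univ : Finset (Fin n)).val.map z) (k := k)
    (by simpa using hk.le)
  rw [Multiset.map_map, Multiset.card_map, Finset.card_val, Finset.card_univ, Fintype.card_fin,
    Finset.esymm_map_val] at h
  rw [symmetrization, Fin.val_mk, Nat.sub_add_cancel (by omega)]
  exact h

lemma symmetrization_eq_iff {n : ℕ} {z w : Fin n → ℂ} :
    symmetrization n z = symmetrization n w ↔
      ∏ j, (X - C (z j)) = ∏ j, (X - C (w j)) := by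
  refine ⟨fun h => Polynomial.ext fun k => ?_, fun h => funext fun k => ?_⟩
  · rcases lt_trichotomy k n with hk | rfl | hk
    · rw [coeff_prod_X_sub z hk, coeff_prod_X_sub w hk, h]
    · have h1 := (monic_prod_X_sub z).coeff_natDegree
      have h2 := (monic_prod_X_sub w).coeff_natDegree
      rw [natDegree_prod_X_sub] at h1 h2
      rw [h1, h2]
    · rw [coeff_eq_zero_of_natDegree_lt (by rwa [natDegree_prod_X_sub]),
        coeff_eq_zero_of_natDegree_lt (by rwa [natDegree_prod_X_sub])]
  -- Entry k of the symmetrization has degree k + 1, so it appears in the coefficient of index n - 1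
  -- - k.
  · have hk : n - 1 - (k : ℕ) < n := by omega
    have h1 := coeff_prod_X_sub z hk
    rw [h, coeff_prod_X_sub w hk] at h1
    have hk' : (⟨n - (n - 1 - (k : ℕ)) - 1, by omega⟩ : Fin n) = k := by
      ext
      simp only
      omega
    rw [hk'] at h1
    exact (mul_left_cancel₀ (pow_ne_zero _ (neg_ne_zero.2 one_ne_zero)) h1).symm

lemma continuous_symmetrization (n : ℕ) : Continuous (symmetrization n) := by
  refine continuous_pi fun k => ?_
  simp only [symmetrization]
  fun_prop

/-- The symmetrized polydisc is saturated: all its preimages lie in the polydisc. -/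
lemma mem_polydisc_of_symmetrization_mem {n : ℕ} {z : Fin n → ℂ}
    (hz : symmetrization n z ∈ symmetrizedPolydisc n) : z ∈ polydisc n := by
  obtain ⟨w, hw, h⟩ := hz
  intro j
  have h1 : (∏ j, (X - C (w j))).IsRoot (z j) := by
    rw [symmetrization_eq_iff.1 h]
    exact isRoot_prod_X_sub.2 ⟨j, rfl⟩
  obtain ⟨i, hi⟩ := isRoot_prod_X_sub.1 h1
  rw [hi]
  exact hw i

/-! ### Proper maps into the symmetrized polydisc. -/

variable {n : ℕ} {f : (Fin n → ℂ) → (Fin n → ℂ)}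

/-- A map of the form `symmetrization ∘ (B₁ × ⋯ × Bₙ)` is proper. -/
theorem isProperMap_of_forall_eq_symmetrization (hf : ContinuousOn f (polydisc n))
    (hmaps : Set.MapsTo f (polydisc n) (symmetrizedPolydisc n)) {B : Fin n → ℂ → ℂ}
    (hB : ∀ j, IsFiniteBlaschkeProduct (B j))
    (hfB : ∀ z ∈ polydisc n, f z = symmetrization n (fun j => B j (z j))) :
    IsProperMap (Set.MapsTo.restrict f (polydisc n) (symmetrizedPolydisc n) hmaps) := by
  refine isProperMap_iff_isCompact_preimage.2 ⟨hf.mapsToRestrict hmaps, fun K hK => ?_⟩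
  have hK' : IsCompact (Subtype.val '' K) := Subtype.isCompact_iff.1 hK
  have hL : IsClosed (symmetrization n ⁻¹' (Subtype.val '' K)) :=
    hK'.isClosed.preimage (continuous_symmetrization n)
  -- By saturation the full preimage of K in ℂⁿ is a closed subset of the polydisc, hence lies in a
  -- smaller ball. Blaschke products exceed its radius near the circle, which confines the preimage
  -- under f.
  obtain ⟨r, hr, hLr⟩ := exists_lt_subset_ball hL (x := 0) (r := 1) (by
    rintro z ⟨y, -, hy⟩
    rw [← polydisc_eq_ball]
    exact mem_polydisc_of_symmetrization_mem (hy ▸ y.2))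
  obtain ⟨ρ, hρ, H⟩ := eventually_unitCircleFilter.1 (eventually_all.2 fun j =>
    (tendsto_norm_of_isFiniteBlaschkeProduct (hB j)).eventually (lt_mem_nhds hr))
  set σ := max ρ 0 with hσ
  have hσ1 : closedBall (0 : Fin n → ℂ) σ ⊆ polydisc n := by
    rw [polydisc_eq_ball]
    exact closedBall_subset_ball (max_lt hρ one_pos)
  have hcomp : IsCompact (closedBall (0 : Fin n → ℂ) σ ∩ f ⁻¹' (Subtype.val '' K)) :=
    (isCompact_closedBall _ _).of_isClosed_subset
      ((hf.mono hσ1).preimage_isClosed_of_isClosed isClosed_closedBall hK'.isClosed)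
      inter_subset_left
  rw [Subtype.isCompact_iff]
  convert hcomp using 1
  ext z
  constructor
  · rintro ⟨⟨z, hz⟩, hzK, rfl⟩
    have hfz : f z ∈ Subtype.val '' K := ⟨_, hzK, rfl⟩
    refine ⟨?_, hfz⟩
    rw [mem_closedBall_zero_iff, pi_norm_le_iff_of_nonneg (le_max_right _ _)]
    intro j
    by_contra hj
    have h1 := H (z j) ((le_max_left _ _).trans_lt (not_le.1 hj)) (hz j) j
    have h2 : (fun j => B j (z j)) ∈ ball (0 : Fin n → ℂ) r := hLr (by
      rw [mem_preimage, ← hfB z hz]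
      exact hfz)
    rw [mem_ball_zero_iff] at h2
    exact absurd (norm_le_pi_norm (fun j => B j (z j)) j) (not_le.2 (h2.trans h1))
  · rintro ⟨hz, y, hy, hyz⟩
    refine ⟨⟨z, hσ1 hz⟩, ?_, rfl⟩
    rw [mem_preimage]
    convert hy
    exact Subtype.ext hyz.symm

/-- Along each coordinate axis, a proper map has a preimage point near the torus. -/
lemma tendsto_norm_of_isProperMap (hmaps : Set.MapsTo f (polydisc n) (symmetrizedPolydisc n))
    (hprop : IsProperMap (Set.MapsTo.restrict f (polydisc n) (symmetrizedPolydisc n) hmaps))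
    {Z : (Fin n → ℂ) → Fin n → ℂ} (hZ : ∀ μ ∈ polydisc n, Z μ ∈ polydisc n)
    (hZf : ∀ μ ∈ polydisc n, symmetrization n (Z μ) = f μ) (i : Fin n) :
    Tendsto (fun z => ‖Z (Function.update 0 i z)‖) unitCircleFilter (𝓝 1) := by
  have mem : ∀ {z : ℂ}, ‖z‖ < 1 → Function.update (0 : Fin n → ℂ) i z ∈ polydisc n :=
    fun hz => update_mem_polydisc (zero_mem_polydisc n) i hz
  refine tendsto_order.2 ⟨fun r hr => ?_, fun r hr => ?_⟩
  · have hsub : symmetrization n '' closedBall 0 r ⊆ symmetrizedPolydisc n :=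
      image_mono (polydisc_eq_ball n ▸ closedBall_subset_ball hr)
    have hK : IsCompact ((Subtype.val : symmetrizedPolydisc n → _) ⁻¹'
        (symmetrization n '' closedBall 0 r)) := by
      rw [Subtype.isCompact_iff, Subtype.image_preimage_coe, inter_eq_right.2 hsub]
      exact (isCompact_closedBall _ _).image (continuous_symmetrization n)
    have hpre := (Subtype.isCompact_iff.1 (hprop.isCompact_preimage hK)).isClosed
    obtain ⟨ρ, hρ, hρsub⟩ := exists_lt_subset_ball hpre (x := 0) (r := 1) (by
      rintro _ ⟨y, -, rfl⟩
      rw [← polydisc_eq_ball]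
      exact y.2)
    filter_upwards [eventually_norm_lt_one, eventually_lt_norm hρ] with z hz hzρ
    by_contra hcon
    have h1 : Function.update (0 : Fin n → ℂ) i z ∈ ball (0 : Fin n → ℂ) ρ := by
      refine hρsub ⟨⟨_, mem hz⟩, ?_, rfl⟩
      exact ⟨_, by simpa using hcon, hZf _ (mem hz)⟩
    rw [mem_ball_zero_iff] at h1
    have h2 := norm_le_pi_norm (Function.update (0 : Fin n → ℂ) i z) i
    rw [Function.update_self] at h2
    linarith
  · filter_upwards [eventually_norm_lt_one] with z hz
    have := hZ _ (mem hz)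
    rw [polydisc_eq_ball, mem_ball_zero_iff] at this
    exact this.trans hr

/-- The lift `Z` need not be continuous: only the coefficients must be holomorphic, and up to sign
the nonleading ones are components of f. The boundary root is a coordinate of `Z` of largest
modulus. -/
lemma exists_isProperFamily (hn : 1 ≤ n) (hf : DifferentiableOn ℂ f (polydisc n))
    (hmaps : Set.MapsTo f (polydisc n) (symmetrizedPolydisc n))
    (hprop : IsProperMap (Set.MapsTo.restrict f (polydisc n) (symmetrizedPolydisc n) hmaps)) :
    ∃ Z : (Fin n → ℂ) → Fin n → ℂ, (∀ μ ∈ polydisc n, symmetrization n (Z μ) = f μ) ∧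
      IsProperFamily n n (fun μ => ∏ j, (X - C (Z μ j))) := by
  have hex : ∀ μ, ∃ w, μ ∈ polydisc n → w ∈ polydisc n ∧ symmetrization n w = f μ := by
    intro μ
    by_cases hμ : μ ∈ polydisc n
    · obtain ⟨w, hw⟩ := hmaps hμ
      exact ⟨w, fun _ => hw⟩
    · exact ⟨0, fun h => absurd h hμ⟩
  choose Z hZ using hex
  refine ⟨Z, fun μ hμ => (hZ μ hμ).2, fun μ _ => monic_prod_X_sub _,
    fun μ _ => natDegree_prod_X_sub _, fun k => ?_, fun μ hμ w hw => ?_, fun i => ?_⟩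
  · rcases lt_trichotomy k n with hk | rfl | hk
    · refine (((differentiableOn_pi.1 hf) ⟨n - k - 1, by omega⟩).const_mul
        ((-1) ^ (n - k))).congr fun μ hμ => ?_
      rw [coeff_prod_X_sub _ hk, (hZ μ hμ).2]
    · refine (differentiableOn_const 1).congr fun μ _ => ?_
      have h1 := (monic_prod_X_sub (Z μ)).coeff_natDegree
      rwa [natDegree_prod_X_sub] at h1
    · refine (differentiableOn_const 0).congr fun μ _ => ?_
      exact coeff_eq_zero_of_natDegree_lt (by rwa [natDegree_prod_X_sub])
  · obtain ⟨j, rfl⟩ := isRoot_prod_X_sub.1 hw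
    exact (hZ μ hμ).1 j
  · have : Nonempty (Fin n) := ⟨⟨0, hn⟩⟩
    have hmax : ∀ w : Fin n → ℂ, ∃ j, ‖w j‖ = ‖w‖ := fun w => by
      obtain ⟨j, hj⟩ := Finite.exists_max fun j => ‖w j‖
      exact ⟨j, le_antisymm (norm_le_pi_norm w j)
        ((pi_norm_le_iff_of_nonneg (norm_nonneg _)).2 hj)⟩
    choose J hJ using hmax
    refine ⟨fun z => Z (Function.update 0 i z) (J (Z (Function.update 0 i z))), ?_,
      Eventually.of_forall fun z => isRoot_prod_X_sub.2 ⟨_, rfl⟩⟩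
    simp only [hJ]
    exact tendsto_norm_of_isProperMap hmaps hprop (fun μ hμ => (hZ μ hμ).1)
      (fun μ hμ => (hZ μ hμ).2) i

/-- A proper holomorphic map from the polydisc to the symmetrized polydisc is the symmetrization of
a product of finite Blaschke products. -/
theorem exists_blaschke_of_isProperMap (hn : 1 ≤ n) (hf : DifferentiableOn ℂ f (polydisc n))
    (hmaps : Set.MapsTo f (polydisc n) (symmetrizedPolydisc n))
    (hprop : IsProperMap (Set.MapsTo.restrict f (polydisc n) (symmetrizedPolydisc n) hmaps)) :
    ∃ B : Fin n → ℂ → ℂ, (∀ j, IsFiniteBlaschkeProduct (B j)) ∧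
      ∀ z ∈ polydisc n, f z = symmetrization n (fun j => B j (z j)) := by
  obtain ⟨Z, hZ, hP⟩ := exists_isProperFamily hn hf hmaps hprop
  obtain ⟨b, hb, heq⟩ := hP.exists_eq_prod hn
  have hb1 : ∀ j z, ‖z‖ < 1 → ‖b j z‖ < 1 := fun j z hz => by
    have m := update_mem_polydisc (zero_mem_polydisc n) j hz
    refine hP.norm_lt_one _ m _ ?_
    simp only [heq _ m]
    exact isRoot_prod_X_sub.2 ⟨j, by rw [Function.update_self]⟩
  refine ⟨b, fun i => isFiniteBlaschkeProduct_of_tendsto_norm (hb i) (hb1 i) ?_,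
    fun z hz => ?_⟩
  · obtain ⟨W, hW, hroot⟩ := hP.exists_root i
    refine hW.congr' ?_
    -- Near the circle W(z) is larger than every fixed value b_j(0), so the root W(z) can only be
    -- b_i(z).
    have hlt : ∀ᶠ z in unitCircleFilter, ∀ j, ‖b j 0‖ < ‖W z‖ :=
      eventually_all.2 fun j => hW.eventually (lt_mem_nhds (hb1 j 0 (by simp)))
    filter_upwards [hroot, hlt, eventually_norm_lt_one] with z hz hzlt hz1
    simp only [heq _ (update_mem_polydisc (zero_mem_polydisc n) i hz1)] at hz
    obtain ⟨j, hj⟩ := isRoot_prod_X_sub.1 hz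
    rcases eq_or_ne j i with rfl | hji
    · rw [hj, Function.update_self]
    · rw [Function.update_of_ne hji, Pi.zero_apply] at hj
      exact absurd (hj ▸ hzlt j) (lt_irrefl _)
  · rw [← hZ z hz]
    exact symmetrization_eq_iff.2 (heq z hz)

theorem theorem2 (n : ℕ) (hn : 1 ≤ n) (f : (Fin n → ℂ) → (Fin n → ℂ))
    (hf : DifferentiableOn ℂ f (polydisc n))
    (hmaps : Set.MapsTo f (polydisc n) (symmetrizedPolydisc n)) :
    IsProperMap (Set.MapsTo.restrict f (polydisc n) (symmetrizedPolydisc n) hmaps) ↔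
      ∃ B : Fin n → ℂ → ℂ, (∀ j, IsFiniteBlaschkeProduct (B j)) ∧
        ∀ z ∈ polydisc n, f z = symmetrization n (fun j => B j (z j)) :=
  ⟨exists_blaschke_of_isProperMap hn hf hmaps, fun ⟨_, hB, hfB⟩ =>
    isProperMap_of_forall_eq_symmetrization hf.continuousOn hmaps hB hfB⟩
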